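/- Let $\Omega\subset\mathbb R^2$ be a bounded open set (for instance with Lipschitz boundary), let $\lambda>0$, and let $f:\Omega\to\mathbb R^d$ be a measurable image. Let $\mathbf D_F,\mathbf D_B$ be two denoising networks (arbitrary maps from images to images, depending on parameters $F\in\mathbb R^{L_1}$ and $B\in\mathbb R^{L_2}$), fix $\boldsymbol W=(F,B)$, and suppose that the outputs $\mathbf D_F(f),\mathbf D_B(f):\Omega\to\mathbb R^d$ are measurable. For integrable $u:\Omega\to\mathbb R$ let $$|u|_{\mathrm{TV}}=\sup\Big\{\int_\Omega u\,\operatorname{div}\varphi\,dx \;:\; \varphi\in C^1_c(\Omega;\mathbb R^2),\ |\varphi|\le 1\Big\},$$ let $\mathrm{BV}(\Omega)$ be the set of integrable $u$ with $|u|_{\mathrm{TV}}<\infty$, let $\mathbb A=\{u\in \mathrm{BV}(\Omega): 0\le u\le 1 \text{ a.e.}\}$, and let $i_{\mathbb A}$ be $0$ on $\mathbb A$ and $\infty$ elsewhere. For $u\in\mathrm{BV}(\Omega)$ put $$\mathcal E_{f,\lambda}(u,\boldsymbol W)=i_{\mathbb A}(u)+\lambda|u|_{\mathrm{TV}}+\int_\Omega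 |f-\mathbf D_F(f)|^2\,u\,dx+\int_\Omega |f-\mathbf D_B(f)|^2(1-u)\,dx\in[0,\infty]$$ (understood as $\infty$ for $u\notin\mathbb A$), and for Lebesgue measurable $\Sigma\subset\Omega$ put $$\mathcal E(\Sigma,\boldsymbol W)=\lambda\operatorname{Per}(\Sigma,\Omega)+\int_\Sigma|f-\mathbf D_F(f)|^2dx+\int_{\Omega\setminus\Sigma}|f-\mathbf D_B(f)|^2dx\in[0,\infty],$$ where $\operatorname{Per}(\Sigma,\Omega)=|\mathbf 1_\Sigma|_{\mathrm{TV}}$. Then $\mathcal E_{f,\lambda}(\cdot,\boldsymbol W)$ has a global minimiser in $\mathrm{BV}(\Omega)$, and for every global minimiser $u\in\mathrm{BV}(\Omega)$ of $\mathcal E_{f,\lambda}(\cdot,\boldsymbol W)$ and almost every $\tau\in[0,1]$, the set $\Sigma(\tau)=\{x\in\Omega: u(x)\ge\tau\}$ is a global minimiser of $\mathcal E(\cdot,\boldsymbol W)$ among all Lebesgue measurable subsets of $\Omega$. -/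

import Mathlib

open MeasureTheory
open scoped ENNReal

noncomputable section

/-- The plane `ℝ²` with the Euclidean norm. -/
abbrev Plane : Type := EuclideanSpace ℝ (Fin 2)

/-- Images with `d` channels. Only the values on the image domain matter. -/
abbrev Image (d : ℕ) : Type := Plane → EuclideanSpace ℝ (Fin d)

/-- The divergence of a vector field on the plane. -/
def divergence (φ : Plane → Plane) (x : Plane) : ℝ :=
  ∑ i : Fin 2, (fderiv ℝ φ x (EuclideanSpace.single i 1)) i

/-- Vector fields of class `C¹`, with compact support inside `Ω`, bounded by one pointwise in the
Euclidean norm. -/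
def testFields (Ω : Set Plane) : Set (Plane → Plane) :=
  {φ | ContDiff ℝ 1 φ ∧ HasCompactSupport φ ∧ tsupport φ ⊆ Ω ∧ ∀ x, ‖φ x‖ ≤ 1}

/-- The (isotropic) total variation in `Ω` of a function that is integrable on `Ω`, an element of
`[0, ∞]`: the supremum of `∫_Ω u div φ` over all test fields `φ`. -/
def totalVariation (Ω : Set Plane) (u : Plane → ℝ) : ℝ≥0∞ :=
  ⨆ φ ∈ testFields Ω, ENNReal.ofReal (∫ x in Ω, u x * divergence φ x)

/-- `BV(Ω)`: integrable functions on `Ω` with finite total variation. -/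
def BV (Ω : Set Plane) : Set (Plane → ℝ) :=
  {u | IntegrableOn u Ω ∧ totalVariation Ω u < ∞}

/-- The admissible functions: those `u` in `BV(Ω)` with `0 ≤ u ≤ 1` (almost everywhere in `Ω`). -/
def admissibleSet (Ω : Set Plane) : Set (Plane → ℝ) :=
  {u | u ∈ BV Ω ∧ ∀ᵐ x ∂(volume.restrict Ω), 0 ≤ u x ∧ u x ≤ 1}

/-- The indicator function of the box constraint: `0` on the admissible set, `∞` elsewhere. -/
def boxIndicator (Ω : Set Plane) : (Plane → ℝ) → ℝ≥0∞ :=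
  (admissibleSet Ω)ᶜ.indicator (fun _ => ∞)

/-- The perimeter of `S` in `Ω`: the total variation in `Ω` of the characteristic function. -/
def perimeter (S Ω : Set Plane) : ℝ≥0∞ :=
  totalVariation Ω (S.indicator (fun _ => (1 : ℝ)))

/-- The convex relaxed energy of `u ∈ BV(Ω)` for the network parameters `W = (F, B)`. For
`u` outside the admissible set its value is `∞`; on it the integrands are nonnegative. -/
def relaxedEnergy {d L₁ L₂ : ℕ} (Ω : Set Plane) (lam : ℝ)
    (DF : (Fin L₁ → ℝ) → Image d → Image d) (DB : (Fin L₂ → ℝ) → Image d → Image d)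
    (f : Image d) (W : (Fin L₁ → ℝ) × (Fin L₂ → ℝ)) (u : Plane → ℝ) : ℝ≥0∞ :=
  boxIndicator Ω u + ENNReal.ofReal lam * totalVariation Ω u
    + (∫⁻ x in Ω, ENNReal.ofReal (‖f x - DF W.1 f x‖ ^ 2 * u x))
    + ∫⁻ x in Ω, ENNReal.ofReal (‖f x - DB W.2 f x‖ ^ 2 * (1 - u x))

/-- The regions of the image domain: Lebesgue measurable subsets of `Ω`. -/
def regions (Ω : Set Plane) : Set (Set Plane) :=
  {S | S ⊆ Ω ∧ NullMeasurableSet S volume}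

/-- The non-convex energy of a region for the network parameters `W = (F, B)`. -/
def regionEnergy {d L₁ L₂ : ℕ} (Ω : Set Plane) (lam : ℝ)
    (DF : (Fin L₁ → ℝ) → Image d → Image d) (DB : (Fin L₂ → ℝ) → Image d → Image d)
    (f : Image d) (W : (Fin L₁ → ℝ) × (Fin L₂ → ℝ)) (S : Set Plane) : ℝ≥0∞ :=
  ENNReal.ofReal lam * perimeter S Ω
    + (∫⁻ x in S, ENNReal.ofReal (‖f x - DF W.1 f x‖ ^ 2))
    + ∫⁻ x in Ω \ S, ENNReal.ofReal (‖f x - DB W.2 f x‖ ^ 2)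

/-- The superlevel set `Σ(τ)` of `u` in `Ω`. -/
def superlevelSet (Ω : Set Plane) (u : Plane → ℝ) (τ : ℝ) : Set Plane :=
  {x | x ∈ Ω ∧ τ ≤ u x}

end

/-!
Write `M` for the measurable functions on `Ω` with values in `[0, 1]` (`unitFunctions`) and `E` for
the energy `λ |u|_TV + ∫ (p u + q (1 - u))` (`tvEnergy`), where `p` and `q` are the squared residuals
of the two networks. On `M` the relaxed energy is `E`, and the energy of a region is `E` of its
characteristic function, so everything reduces to minimising `E` over `M`.

*Existence.* `E` is convex and lower semicontinuous under almost everywhere convergence, so its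
sublevel sets are closed convex bounded subsets of `L²(Ω)`. A decreasing sequence of such sets has a
common point (`nonempty_iInter_of_antitone_convex`), and a common point of the sublevel sets at
levels tending to the infimum is a minimiser. No compactness in `BV` is needed, hence no regularity
of the boundary.

*Superlevel sets.* The coarea formula is replaced by its two-piece form
`|min(u, t)|_TV + |u - min(u, t)|_TV ≤ |u|_TV` (`totalVariation_truncation_le`). For a smooth `v` in
place of `u` and a smooth `h` with `0 ≤ h' ≤ 1` in place of `min(·, t)`, testing `h(v)` with `φ` and
`v - h(v)` with `ψ` is the same as testing `v` with the field `h'(v) φ + (1 - h'(v)) ψ`, which again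
has norm at most one (`integral_comp_mul_divergence_add`). Testing a mollification of `u` with a
field of compact support costs at most `|u|_TV` (`ofReal_integral_convolution_le`), and the general
inequality follows in the limit.

For `0 < t < 1` put `v = min(u, t) / t` and `w = (u - min(u, t)) / (1 - t)`. These lie in `M`, the
data terms are affine along `u = t v + (1 - t) w`, and so `t E(v) + (1 - t) E(w) ≤ E(u)`. If `u` is a
minimiser, then `v` and `w` are minimisers too (`isMinOn_truncation`). Truncating at `τ` and then,
from the other side, at levels tending to `1`, produces minimisers that converge to the
characteristic function of `{u ≥ τ}`, which is thus a minimiser of `E` by lower semicontinuity. This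
covers every `τ` in the open interval `(0, 1)`.

When the infimum of `E` is infinite, every function in `BV(Ω)` and every region is a minimiser.
-/

open Filter Topology

/-! ### Total variation as a functional on measurable functions -/

lemma continuous_divergence {φ : Plane → Plane} (hφ : ContDiff ℝ 1 φ) :
    Continuous (divergence φ) := by
  have h := hφ.continuous_fderiv one_ne_zero
  unfold divergence
  fun_prop

lemma hasCompactSupport_divergence {φ : Plane → Plane} (hφ : HasCompactSupport φ) :
    HasCompactSupport (divergence φ) := by
  refine (hφ.fderiv (𝕜 := ℝ)).mono fun x hx => ?_
  contrapose! hx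
  simp only [Function.mem_support, ne_eq, not_not] at hx ⊢
  simp [divergence, hx]

lemma exists_bound_divergence {φ : Plane → Plane} {Ω : Set Plane} (hφ : φ ∈ testFields Ω) :
    ∃ C, ∀ x, ‖divergence φ x‖ ≤ C :=
  (hasCompactSupport_divergence hφ.2.1).exists_bound_of_continuous (continuous_divergence hφ.1)

lemma zero_mem_testFields (Ω : Set Plane) : (0 : Plane → Plane) ∈ testFields Ω := by
  refine ⟨contDiff_const, HasCompactSupport.zero, ?_, by simp⟩
  simp [tsupport]

lemma divergence_zero : divergence 0 = 0 := by
  ext x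
  simp [divergence]

lemma integrableOn_mul_divergence {Ω : Set Plane} {u : Plane → ℝ} {φ : Plane → Plane}
    (hu : IntegrableOn u Ω) (hφ : φ ∈ testFields Ω) :
    IntegrableOn (fun x => u x * divergence φ x) Ω := by
  obtain ⟨C, hC⟩ := exists_bound_divergence hφ
  exact Integrable.mul_bdd hu
    (continuous_divergence hφ.1).aestronglyMeasurable (ae_of_all _ hC)

lemma ofReal_integral_le_totalVariation {Ω : Set Plane} (u : Plane → ℝ) {φ : Plane → Plane}
    (hφ : φ ∈ testFields Ω) :
    ENNReal.ofReal (∫ x in Ω, u x * divergence φ x) ≤ totalVariation Ω u :=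
  le_iSup₂ (f := fun φ (_ : φ ∈ testFields Ω) =>
    ENNReal.ofReal (∫ x in Ω, u x * divergence φ x)) φ hφ

lemma totalVariation_congr {Ω : Set Plane} {u v : Plane → ℝ}
    (h : u =ᵐ[volume.restrict Ω] v) : totalVariation Ω u = totalVariation Ω v := by
  unfold totalVariation
  refine iSup_congr fun φ => iSup_congr fun _ => congrArg ENNReal.ofReal ?_
  refine integral_congr_ae ?_
  filter_upwards [h] with x hx
  rw [hx]

lemma totalVariation_const_mul (Ω : Set Plane) {c : ℝ} (hc : 0 ≤ c) (u : Plane → ℝ) :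
    totalVariation Ω (fun x => c * u x) = ENNReal.ofReal c * totalVariation Ω u := by
  unfold totalVariation
  simp_rw [ENNReal.mul_iSup, mul_assoc, integral_const_mul, ENNReal.ofReal_mul hc]

lemma totalVariation_add_le {Ω : Set Plane} {u v : Plane → ℝ}
    (hu : IntegrableOn u Ω) (hv : IntegrableOn v Ω) :
    totalVariation Ω (fun x => u x + v x) ≤ totalVariation Ω u + totalVariation Ω v := by
  refine iSup₂_le fun φ hφ => ?_
  simp_rw [add_mul]
  rw [integral_add (integrableOn_mul_divergence hu hφ) (integrableOn_mul_divergence hv hφ)]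
  exact ENNReal.ofReal_add_le.trans
    (add_le_add (ofReal_integral_le_totalVariation u hφ) (ofReal_integral_le_totalVariation v hφ))

lemma totalVariation_zero (Ω : Set Plane) : totalVariation Ω 0 = 0 := by
  simp [totalVariation]

/-- The measurable functions on `Ω` with values in `[0, 1]` almost everywhere. -/
def unitFunctions (Ω : Set Plane) : Set (Plane → ℝ) :=
  {u | AEStronglyMeasurable u (volume.restrict Ω) ∧
    ∀ᵐ x ∂(volume.restrict Ω), 0 ≤ u x ∧ u x ≤ 1}

lemma norm_le_one_of_mem_unitFunctions {Ω : Set Plane} {u : Plane → ℝ}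
    (hu : u ∈ unitFunctions Ω) : ∀ᵐ x ∂(volume.restrict Ω), ‖u x‖ ≤ 1 := by
  filter_upwards [hu.2] with x hx
  rw [Real.norm_eq_abs, abs_le]
  constructor <;> linarith [hx.1, hx.2]

lemma integrableOn_of_mem_unitFunctions {Ω : Set Plane} (hΩ : volume Ω < ∞) {u : Plane → ℝ}
    (hu : u ∈ unitFunctions Ω) : IntegrableOn u Ω :=
  IntegrableOn.of_bound hΩ hu.1 1 (norm_le_one_of_mem_unitFunctions hu)

lemma mem_unitFunctions_of_tendsto {Ω : Set Plane} {u : ℕ → Plane → ℝ} {v : Plane → ℝ}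
    (hu : ∀ n, u n ∈ unitFunctions Ω)
    (h : ∀ᵐ x ∂(volume.restrict Ω), Tendsto (fun n => u n x) atTop (𝓝 (v x))) :
    v ∈ unitFunctions Ω := by
  refine ⟨aestronglyMeasurable_of_tendsto_ae atTop (fun n => (hu n).1) h, ?_⟩
  filter_upwards [h, ae_all_iff.2 fun n => (hu n).2] with x hx hux
  exact ⟨ge_of_tendsto' hx fun n => (hux n).1, le_of_tendsto' hx fun n => (hux n).2⟩

lemma tendsto_integral_mul_divergence {Ω : Set Plane} (hΩ : volume Ω < ∞)
    {u : ℕ → Plane → ℝ} {v : Plane → ℝ} {C : ℝ}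
    (hm : ∀ n, AEStronglyMeasurable (u n) (volume.restrict Ω))
    (hb : ∀ n, ∀ᵐ x ∂(volume.restrict Ω), ‖u n x‖ ≤ C)
    (h : ∀ᵐ x ∂(volume.restrict Ω), Tendsto (fun n => u n x) atTop (𝓝 (v x)))
    {φ : Plane → Plane} (hφ : φ ∈ testFields Ω) :
    Tendsto (fun n => ∫ x in Ω, u n x * divergence φ x) atTop
      (𝓝 (∫ x in Ω, v x * divergence φ x)) := by
  have : IsFiniteMeasure (volume.restrict Ω) := ⟨by simpa using hΩ⟩
  obtain ⟨D, hD⟩ := exists_bound_divergence hφ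
  refine tendsto_integral_of_dominated_convergence (fun _ => C * D)
    (fun n => (hm n).mul (continuous_divergence hφ.1).aestronglyMeasurable)
    (integrable_const _) (fun n => ?_) ?_
  · filter_upwards [hb n] with x hx
    rw [norm_mul]
    exact mul_le_mul hx (hD x) (norm_nonneg _) ((norm_nonneg _).trans hx)
  · filter_upwards [h] with x hx
    exact hx.mul_const _

/-- Total variation is a supremum of functionals that are continuous under bounded almost
everywhere convergence. -/
lemma totalVariation_le_liminf {Ω : Set Plane} (hΩ : volume Ω < ∞)
    {u : ℕ → Plane → ℝ} {v : Plane → ℝ} (hu : ∀ n, u n ∈ unitFunctions Ω)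
    (h : ∀ᵐ x ∂(volume.restrict Ω), Tendsto (fun n => u n x) atTop (𝓝 (v x))) :
    totalVariation Ω v ≤ liminf (fun n => totalVariation Ω (u n)) atTop := by
  refine iSup₂_le fun φ hφ => ?_
  have ht := ENNReal.tendsto_ofReal (tendsto_integral_mul_divergence hΩ (fun n => (hu n).1)
    (fun n => norm_le_one_of_mem_unitFunctions (hu n)) h hφ)
  rw [← ht.liminf_eq]
  exact liminf_le_liminf (Eventually.of_forall fun n => ofReal_integral_le_totalVariation _ hφ)

/-! ### The energy without the box constraint -/

/-- The total variation energy with data terms `p` on `u` and `q` on `1 - u`, without the box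
constraint. The two data terms share one integral. -/
noncomputable def tvEnergy (Ω : Set Plane) (lam : ℝ) (p q u : Plane → ℝ) : ℝ≥0∞ :=
  ENNReal.ofReal lam * totalVariation Ω u
    + ∫⁻ x in Ω, (ENNReal.ofReal (p x * u x) + ENNReal.ofReal (q x * (1 - u x)))

lemma tvEnergy_congr {Ω : Set Plane} {lam : ℝ} {p q u v : Plane → ℝ}
    (h : u =ᵐ[volume.restrict Ω] v) : tvEnergy Ω lam p q u = tvEnergy Ω lam p q v := by
  unfold tvEnergy
  rw [totalVariation_congr h]
  congr 1
  refine lintegral_congr_ae ?_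
  filter_upwards [h] with x hx
  rw [hx]

lemma liminf_add_liminf_le (a b : ℕ → ℝ≥0∞) :
    liminf a atTop + liminf b atTop ≤ liminf (fun n => a n + b n) atTop := by
  simp only [liminf_eq_iSup_iInf_of_nat]
  rw [ENNReal.iSup_add_iSup_of_monotone]
  · exact iSup_mono fun n => le_iInf₂ fun i hi => add_le_add (iInf₂_le i hi) (iInf₂_le i hi)
  · exact fun m n hmn => le_iInf₂ fun i hi => iInf₂_le i (hmn.trans hi)
  · exact fun m n hmn => le_iInf₂ fun i hi => iInf₂_le i (hmn.trans hi)

/-- Lower semicontinuity. The data weights need not be integrable, so the data terms are handled by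
Fatou's lemma. -/
lemma tvEnergy_le_of_tendsto {Ω : Set Plane} (hΩ : volume Ω < ∞) {lam : ℝ} {p q : Plane → ℝ}
    (hp : AEMeasurable p (volume.restrict Ω)) (hq : AEMeasurable q (volume.restrict Ω))
    {u : ℕ → Plane → ℝ} {v : Plane → ℝ} (hu : ∀ n, u n ∈ unitFunctions Ω)
    (h : ∀ᵐ x ∂(volume.restrict Ω), Tendsto (fun n => u n x) atTop (𝓝 (v x)))
    {c : ℝ≥0∞} (hc : ∀ n, tvEnergy Ω lam p q (u n) ≤ c) :
    tvEnergy Ω lam p q v ≤ c := by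
  set G : (Plane → ℝ) → Plane → ℝ≥0∞ := fun w x =>
    ENNReal.ofReal (p x * w x) + ENNReal.ofReal (q x * (1 - w x))
  have hfatou : ∫⁻ x in Ω, G v x ≤ liminf (fun n => ∫⁻ x in Ω, G (u n) x) atTop := by
    have hlim : ∀ᵐ x ∂(volume.restrict Ω), G v x = liminf (fun n => G (u n) x) atTop := by
      filter_upwards [h] with x hx
      refine (Tendsto.liminf_eq ?_).symm
      exact (ENNReal.tendsto_ofReal (hx.const_mul _)).add
        (ENNReal.tendsto_ofReal ((hx.const_sub 1).const_mul _))
    rw [lintegral_congr_ae hlim]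
    refine lintegral_liminf_le' fun n => ?_
    have := (hu n).1.aemeasurable
    fun_prop
  have htv : ENNReal.ofReal lam * totalVariation Ω v
      ≤ liminf (fun n => ENNReal.ofReal lam * totalVariation Ω (u n)) atTop := by
    refine (mul_le_mul_right (totalVariation_le_liminf hΩ hu h) _).trans ?_
    exact ENNReal.le_liminf_mul |>.trans' (by simp)
  calc tvEnergy Ω lam p q v
      ≤ liminf (fun n => ENNReal.ofReal lam * totalVariation Ω (u n)) atTop
        + liminf (fun n => ∫⁻ x in Ω, G (u n) x) atTop := add_le_add htv hfatou
    _ ≤ liminf (fun n => tvEnergy Ω lam p q (u n)) atTop :=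
        liminf_add_liminf_le _ _
    _ ≤ c := by
      refine (liminf_le_liminf (Eventually.of_forall hc)).trans ?_
      simp

/-- The data terms are affine along convex combinations of functions with values in `[0, 1]`. -/
lemma lintegral_data_convexCombination {Ω : Set Plane} {p q : Plane → ℝ}
    (hp : AEMeasurable p (volume.restrict Ω)) (hq : AEMeasurable q (volume.restrict Ω))
    (hp0 : ∀ x, 0 ≤ p x) (hq0 : ∀ x, 0 ≤ q x) {a b : ℝ} (ha : 0 ≤ a) (hb : 0 ≤ b)
    (hab : a + b = 1) {v w : Plane → ℝ} (hv : v ∈ unitFunctions Ω) (hw : w ∈ unitFunctions Ω) :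
    ∫⁻ x in Ω, (ENNReal.ofReal (p x * (a * v x + b * w x))
        + ENNReal.ofReal (q x * (1 - (a * v x + b * w x))))
      = ENNReal.ofReal a * (∫⁻ x in Ω, (ENNReal.ofReal (p x * v x)
          + ENNReal.ofReal (q x * (1 - v x))))
        + ENNReal.ofReal b * ∫⁻ x in Ω, (ENNReal.ofReal (p x * w x)
          + ENNReal.ofReal (q x * (1 - w x))) := by
  have hvm := hv.1.aemeasurable
  have hwm := hw.1.aemeasurable
  rw [← lintegral_const_mul' _ _ ENNReal.ofReal_ne_top,
    ← lintegral_const_mul' _ _ ENNReal.ofReal_ne_top, ← lintegral_add_left' (by fun_prop)]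
  refine lintegral_congr_ae ?_
  filter_upwards [hv.2, hw.2] with x hvx hwx
  have h1 : 0 ≤ p x * v x := mul_nonneg (hp0 x) hvx.1
  have h2 : 0 ≤ p x * w x := mul_nonneg (hp0 x) hwx.1
  have h3 : 0 ≤ q x * (1 - v x) := mul_nonneg (hq0 x) (by linarith [hvx.2])
  have h4 : 0 ≤ q x * (1 - w x) := mul_nonneg (hq0 x) (by linarith [hwx.2])
  have e1 : p x * (a * v x + b * w x) = a * (p x * v x) + b * (p x * w x) := by ring
  have e2 : q x * (1 - (a * v x + b * w x)) = a * (q x * (1 - v x)) + b * (q x * (1 - w x)) := by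
    linear_combination (-q x) * hab
  rw [e1, e2, ENNReal.ofReal_add (by positivity) (by positivity),
    ENNReal.ofReal_add (by positivity) (by positivity), ENNReal.ofReal_mul ha,
    ENNReal.ofReal_mul ha, ENNReal.ofReal_mul hb, ENNReal.ofReal_mul hb]
  ring

lemma convexCombination_mem_unitFunctions {Ω : Set Plane} {a b : ℝ} (ha : 0 ≤ a) (hb : 0 ≤ b)
    (hab : a + b = 1) {v w : Plane → ℝ} (hv : v ∈ unitFunctions Ω) (hw : w ∈ unitFunctions Ω) :
    (fun x => a * v x + b * w x) ∈ unitFunctions Ω := by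
  refine ⟨(hv.1.const_mul a).add (hw.1.const_mul b), ?_⟩
  filter_upwards [hv.2, hw.2] with x hvx hwx
  constructor
  · have := mul_nonneg ha hvx.1
    have := mul_nonneg hb hwx.1
    linarith
  · have := mul_le_mul_of_nonneg_left hvx.2 ha
    have := mul_le_mul_of_nonneg_left hwx.2 hb
    linarith

lemma tvEnergy_convexCombination_le {Ω : Set Plane} (hΩ : volume Ω < ∞) {lam : ℝ}
    {p q : Plane → ℝ}
    (hp : AEMeasurable p (volume.restrict Ω)) (hq : AEMeasurable q (volume.restrict Ω))
    (hp0 : ∀ x, 0 ≤ p x) (hq0 : ∀ x, 0 ≤ q x) {a b : ℝ} (ha : 0 ≤ a) (hb : 0 ≤ b)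
    (hab : a + b = 1) {v w : Plane → ℝ} (hv : v ∈ unitFunctions Ω) (hw : w ∈ unitFunctions Ω) :
    tvEnergy Ω lam p q (fun x => a * v x + b * w x)
      ≤ ENNReal.ofReal a * tvEnergy Ω lam p q v + ENNReal.ofReal b * tvEnergy Ω lam p q w := by
  have htv := totalVariation_add_le ((integrableOn_of_mem_unitFunctions hΩ hv).const_mul a)
    ((integrableOn_of_mem_unitFunctions hΩ hw).const_mul b)
  rw [totalVariation_const_mul Ω ha, totalVariation_const_mul Ω hb] at htv
  unfold tvEnergy
  rw [lintegral_data_convexCombination hp hq hp0 hq0 ha hb hab hv hw]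
  calc _ ≤ ENNReal.ofReal lam * (ENNReal.ofReal a * totalVariation Ω v
        + ENNReal.ofReal b * totalVariation Ω w) + _ :=
        add_le_add_left (mul_le_mul_right htv _) _
    _ = _ := by ring

/-! ### A smooth minimum -/

/-- A smooth approximation from below of `s ↦ min s t`; it is `min s t` itself for `δ = 0`. -/
noncomputable def smoothMin (t δ s : ℝ) : ℝ := (s + t - √((s - t) ^ 2 + δ ^ 2)) / 2

/-- The derivative of `smoothMin t δ`. -/
noncomputable def smoothMinDeriv (t δ s : ℝ) : ℝ := (1 - (s - t) / √((s - t) ^ 2 + δ ^ 2)) / 2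

lemma smoothMin_zero (t s : ℝ) : smoothMin t 0 s = min s t := by
  unfold smoothMin
  rw [zero_pow two_ne_zero, add_zero, Real.sqrt_sq_eq_abs]
  rcases le_total s t with h | h
  · rw [min_eq_left h, abs_of_nonpos (by linarith)]; ring
  · rw [min_eq_right h, abs_of_nonneg (by linarith)]; ring

lemma hasDerivAt_smoothMin (t : ℝ) {δ : ℝ} (hδ : 0 < δ) (s : ℝ) :
    HasDerivAt (smoothMin t δ) (smoothMinDeriv t δ s) s := by
  have hpos : 0 < (s - t) ^ 2 + δ ^ 2 := by positivity
  have h1 : HasDerivAt (fun s : ℝ => (s - t) ^ 2 + δ ^ 2) (2 * (s - t)) s := by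
    simpa using (((hasDerivAt_id s).sub_const t).pow 2).add_const (δ ^ 2)
  convert! (((hasDerivAt_id s).add_const t).sub (h1.sqrt hpos.ne')).div_const 2 using 1
  unfold smoothMinDeriv
  have := (Real.sqrt_pos.2 hpos).ne'
  field_simp

lemma contDiff_smoothMinDeriv (t : ℝ) {δ : ℝ} (hδ : 0 < δ) :
    ContDiff ℝ 1 (smoothMinDeriv t δ) := by
  have hpos : ∀ s, 0 < (s - t) ^ 2 + δ ^ 2 := fun s => by positivity
  have h1 : ContDiff ℝ 1 (fun s : ℝ => (s - t) ^ 2 + δ ^ 2) := by fun_prop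
  have h2 : ContDiff ℝ 1 (fun s : ℝ => s - t) := by fun_prop
  exact (contDiff_const.sub (h2.div (h1.sqrt fun s => (hpos s).ne')
    fun s => (Real.sqrt_pos.2 (hpos s)).ne')).div_const 2

lemma continuous_smoothMin (t : ℝ) : Continuous fun p : ℝ × ℝ => smoothMin t p.1 p.2 := by
  unfold smoothMin
  fun_prop

lemma smoothMinDeriv_mem_Icc (t : ℝ) {δ : ℝ} (hδ : 0 < δ) (s : ℝ) :
    0 ≤ smoothMinDeriv t δ s ∧ smoothMinDeriv t δ s ≤ 1 := by
  have hpos : 0 < √((s - t) ^ 2 + δ ^ 2) := Real.sqrt_pos.2 (by positivity)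
  have h : |s - t| ≤ √((s - t) ^ 2 + δ ^ 2) :=
    Real.abs_le_sqrt (by linarith [sq_nonneg δ])
  rw [abs_le] at h
  have h1 : (s - t) / √((s - t) ^ 2 + δ ^ 2) ≤ 1 := (div_le_one hpos).2 h.2
  have h2 : -1 ≤ (s - t) / √((s - t) ^ 2 + δ ^ 2) := (le_div_iff₀ hpos).2 (by linarith)
  unfold smoothMinDeriv
  constructor <;> linarith

lemma abs_smoothMin_le (t : ℝ) {δ : ℝ} (hδ : 0 ≤ δ) (s : ℝ) :
    |smoothMin t δ s| ≤ |s| + |t| + δ := by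
  have h1 : √((s - t) ^ 2 + δ ^ 2) ≤ |s - t| + δ := by
    rw [Real.sqrt_le_left (by positivity), ← sq_abs (s - t)]
    nlinarith [mul_nonneg (abs_nonneg (s - t)) hδ]
  have h2 := abs_sub s t
  have h3 := Real.sqrt_nonneg ((s - t) ^ 2 + δ ^ 2)
  have h4 := abs_add_le s t
  rw [abs_le] at h4
  unfold smoothMin
  rw [abs_le]
  constructor <;> linarith [abs_nonneg s, abs_nonneg t]

/-! ### Integration by parts against test fields -/

lemma fderiv_apply_coord {φ : Plane → Plane} (hφ : ContDiff ℝ 1 φ) (x v : Plane) (i : Fin 2) :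
    fderiv ℝ φ x v i = fderiv ℝ (fun y => φ y i) x v := by
  have h := ((EuclideanSpace.proj i : Plane →L[ℝ] ℝ).hasFDerivAt.comp x
    (hφ.differentiable one_ne_zero x).hasFDerivAt).fderiv
  have h' : fderiv ℝ (fun y => φ y i) x
      = (EuclideanSpace.proj i : Plane →L[ℝ] ℝ).comp (fderiv ℝ φ x) := h
  rw [h']
  rfl

lemma integral_mul_divergence {g : Plane → ℝ} (hg : ContDiff ℝ 1 g) {φ : Plane → Plane}
    (hφ : ContDiff ℝ 1 φ) (hc : HasCompactSupport φ) :
    ∫ x, g x * divergence φ x = -∫ x, fderiv ℝ g x (φ x) := by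
  have hgc := hg.continuous
  have hφi : ∀ i : Fin 2, ContDiff ℝ 1 (fun y => φ y i) := fun i => by fun_prop
  have hci : ∀ i : Fin 2, HasCompactSupport (fun y => φ y i) := fun i => by
    refine hc.mono fun x hx => ?_
    contrapose! hx
    simp only [Function.mem_support, ne_eq, not_not] at hx ⊢
    simp [hx]
  have hφ' : ∀ i : Fin 2, Continuous (fderiv ℝ (fun y => φ y i)) :=
    fun i => (hφi i).continuous_fderiv one_ne_zero
  have hg' := hg.continuous_fderiv one_ne_zero
  let e : Fin 2 → Plane := fun i => EuclideanSpace.single i 1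
  have int1 : ∀ i, Integrable fun x => g x * fderiv ℝ (fun y => φ y i) x (e i) := fun i => by
    refine Continuous.integrable_of_hasCompactSupport (by fun_prop) ?_
    exact ((hci i).fderiv_apply (𝕜 := ℝ) (e i)).mul_left
  have int2 : ∀ i, Integrable fun x => fderiv ℝ g x (e i) * φ x i := fun i => by
    refine Continuous.integrable_of_hasCompactSupport ?_ (hci i).mul_left
    have := (hφi i).continuous
    fun_prop
  have int3 : ∀ i, Integrable fun x => g x * φ x i := fun i => by
    refine Continuous.integrable_of_hasCompactSupport ?_ (hci i).mul_left
    have := (hφi i).continuous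
    fun_prop
  have key : ∀ i, ∫ x, g x * fderiv ℝ (fun y => φ y i) x (e i)
      = -∫ x, fderiv ℝ g x (e i) * φ x i := fun i =>
    integral_mul_fderiv_eq_neg_fderiv_mul_of_integrable (int2 i) (int1 i) (int3 i)
      (fun x _ => hg.differentiable one_ne_zero x)
      (fun x _ => (hφi i).differentiable one_ne_zero x)
  have hdiv : ∀ x, g x * divergence φ x
      = ∑ i, g x * fderiv ℝ (fun y => φ y i) x (e i) := fun x => by
    unfold divergence
    rw [Finset.mul_sum]
    exact Finset.sum_congr rfl fun i _ => by rw [fderiv_apply_coord hφ]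
  have hgrad : ∀ x, fderiv ℝ g x (φ x) = ∑ i, fderiv ℝ g x (e i) * φ x i := fun x => by
    have hx : φ x = ∑ i, φ x i • e i := by
      ext j
      fin_cases j <;> simp [e, Fin.sum_univ_two]
    conv_lhs => rw [hx]
    rw [map_sum]
    exact Finset.sum_congr rfl fun i _ => by rw [map_smul, smul_eq_mul, mul_comm]
  simp_rw [hdiv, hgrad]
  rw [integral_finsetSum _ fun i _ => int1 i, integral_finsetSum _ fun i _ => int2 i,
    ← Finset.sum_neg_distrib]
  exact Finset.sum_congr rfl fun i _ => key i

lemma setIntegral_mul_divergence_eq {Ω : Set Plane} {φ : Plane → Plane} (hφ : φ ∈ testFields Ω)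
    (g : Plane → ℝ) : ∫ x in Ω, g x * divergence φ x = ∫ x, g x * divergence φ x := by
  refine setIntegral_eq_integral_of_forall_compl_eq_zero fun x hx => ?_
  have hx' : fderiv ℝ φ x = 0 := by
    by_contra h
    exact hx (hφ.2.2.1 (support_fderiv_subset ℝ h))
  simp [divergence, hx']

/-- The pointwise convex combination of two test fields with a `C¹` weight. -/
lemma weighted_mem_testFields {Ω : Set Plane} {φ ψ : Plane → Plane} (hφ : φ ∈ testFields Ω)
    (hψ : ψ ∈ testFields Ω) {θ : Plane → ℝ} (hθ : ContDiff ℝ 1 θ)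
    (hθ01 : ∀ x, 0 ≤ θ x ∧ θ x ≤ 1) :
    (fun x => θ x • φ x + (1 - θ x) • ψ x) ∈ testFields Ω ∧
      tsupport (fun x => θ x • φ x + (1 - θ x) • ψ x) ⊆ tsupport φ ∪ tsupport ψ := by
  have hsub : tsupport (fun x => θ x • φ x + (1 - θ x) • ψ x) ⊆ tsupport φ ∪ tsupport ψ := by
    refine closure_minimal (fun x hx => ?_) ((isClosed_tsupport φ).union (isClosed_tsupport ψ))
    by_contra h
    rw [Set.mem_union, not_or] at h
    exact hx (by simp [image_eq_zero_of_notMem_tsupport h.1, image_eq_zero_of_notMem_tsupport h.2])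
  refine ⟨⟨?_, ?_, ?_, fun x => ?_⟩, hsub⟩
  · have h1 := hφ.1
    have h2 := hψ.1
    fun_prop
  · exact (hφ.2.1.isCompact.union hψ.2.1.isCompact).of_isClosed_subset (isClosed_tsupport _) hsub
  · exact hsub.trans (Set.union_subset hφ.2.2.1 hψ.2.2.1)
  · have h0 := (hθ01 x).1
    have h1 : 0 ≤ 1 - θ x := by linarith [(hθ01 x).2]
    calc ‖θ x • φ x + (1 - θ x) • ψ x‖ ≤ ‖θ x • φ x‖ + ‖(1 - θ x) • ψ x‖ := norm_add_le _ _
      _ = θ x * ‖φ x‖ + (1 - θ x) * ‖ψ x‖ := by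
        rw [norm_smul, norm_smul, Real.norm_of_nonneg h0, Real.norm_of_nonneg h1]
      _ ≤ θ x * 1 + (1 - θ x) * 1 := add_le_add (mul_le_mul_of_nonneg_left (hφ.2.2.2 x) h0)
        (mul_le_mul_of_nonneg_left (hψ.2.2.2 x) h1)
      _ = 1 := by ring

/-- Testing the two parts `h ∘ v` and `v - h ∘ v` of a smooth function with two fields amounts to
testing `v` with one field, the combination of the two with weight `h' ∘ v`: by the chain rule both
sides are `-∫ ∇v · (h'(v) φ + (1 - h'(v)) ψ)`. -/
lemma integral_comp_mul_divergence_add {v : Plane → ℝ} (hv : ContDiff ℝ 1 v) {h h' : ℝ → ℝ}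
    (hh : ∀ s, HasDerivAt h (h' s) s) (hh' : ContDiff ℝ 1 h')
    {φ ψ : Plane → Plane} (hφ : ContDiff ℝ 1 φ) (hφc : HasCompactSupport φ)
    (hψ : ContDiff ℝ 1 ψ) (hψc : HasCompactSupport ψ) :
    (∫ x, h (v x) * divergence φ x) + ∫ x, (v x - h (v x)) * divergence ψ x
      = ∫ x, v x * divergence (fun y => h' (v y) • φ y + (1 - h' (v y)) • ψ y) x := by
  have hh1 : ContDiff ℝ 1 h := by
    rw [contDiff_one_iff_deriv]
    refine ⟨fun s => (hh s).differentiableAt, ?_⟩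
    rw [show deriv h = h' from funext fun s => (hh s).deriv]
    exact hh'.continuous
  have hhv : ContDiff ℝ 1 fun x => h (v x) := hh1.comp hv
  have hh'v : ContDiff ℝ 1 fun x => h' (v x) := hh'.comp hv
  have hd1 : ∀ x, fderiv ℝ (fun x => h (v x)) x = h' (v x) • fderiv ℝ v x := fun x =>
    ((hh (v x)).comp_hasFDerivAt x (hv.differentiable one_ne_zero x).hasFDerivAt).fderiv
  have hd2 : ∀ x, fderiv ℝ (fun x => v x - h (v x)) x = (1 - h' (v x)) • fderiv ℝ v x := by
    intro x
    rw [fderiv_fun_sub (hv.differentiable one_ne_zero x) (hhv.differentiable one_ne_zero x), hd1,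
      sub_smul, one_smul]
  have hΦ : ContDiff ℝ 1 fun y => h' (v y) • φ y + (1 - h' (v y)) • ψ y := by fun_prop
  have hΦc : HasCompactSupport fun y => h' (v y) • φ y + (1 - h' (v y)) • ψ y :=
    (hφc.smul_left (f := fun y => h' (v y))).add (hψc.smul_left (f := fun y => 1 - h' (v y)))
  have hv' := hv.continuous_fderiv one_ne_zero
  have hφ0 := hφ.continuous
  have hψ0 := hψ.continuous
  have hh'v0 := hh'v.continuous
  rw [integral_mul_divergence hhv hφ hφc, integral_mul_divergence (hv.sub hhv) hψ hψc,
    integral_mul_divergence hv hΦ hΦc, ← neg_add, ← integral_add]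
  · congr 1
    refine integral_congr_ae (ae_of_all _ fun x => ?_)
    simp [hd1, hd2]
  · simp_rw [hd1]
    refine Continuous.integrable_of_hasCompactSupport ?_ ?_
    · exact (hh'v0.smul hv').clm_apply hφ0
    · refine hφc.mono fun x hx => ?_
      contrapose! hx
      simp only [Function.mem_support, ne_eq, not_not] at hx ⊢
      simp [hx]
  · simp_rw [hd2]
    refine Continuous.integrable_of_hasCompactSupport ?_ ?_
    · exact ((continuous_const.sub hh'v0).smul hv').clm_apply hψ0
    · refine hψc.mono fun x hx => ?_
      contrapose! hx
      simp only [Function.mem_support, ne_eq, not_not] at hx ⊢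
      simp [hx]

/-! ### Mollification -/

lemma translate_mem_testFields {Ω : Set Plane} {Φ : Plane → Plane} (hΦ : Φ ∈ testFields Ω)
    {δ : ℝ} (hδ : Metric.cthickening δ (tsupport Φ) ⊆ Ω) {y : Plane} (hy : ‖y‖ ≤ δ) :
    (fun z => Φ (z + y)) ∈ testFields Ω := by
  have h1 := hΦ.1
  refine ⟨by fun_prop, hΦ.2.1.comp_homeomorph (Homeomorph.addRight y), fun z hz => hδ ?_,
    fun z => hΦ.2.2.2 _⟩
  have hz' : z + y ∈ tsupport Φ :=
    tsupport_comp_subset_preimage Φ (f := fun z => z + y) (by fun_prop) hz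
  exact Metric.mem_cthickening_of_dist_le z (z + y) δ _ hz' (by simpa [dist_eq_norm] using hy)

lemma divergence_translate (Φ : Plane → Plane) (y z : Plane) :
    divergence (fun z => Φ (z + y)) z = divergence Φ (z + y) := by
  unfold divergence
  rw [fderiv_comp_add_right]

/-- Mollification does not increase the variation seen by a test field that stays away from the
boundary: the mollified function is an average of translates, and translating the function is
translating the test field. -/
lemma ofReal_integral_convolution_le {Ω : Set Plane} {u : Plane → ℝ} (hΩ : MeasurableSet Ω)
    (hu : IntegrableOn u Ω) {Φ : Plane → Plane} (hΦ : Φ ∈ testFields Ω) {δ : ℝ}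
    (hδ : Metric.cthickening δ (tsupport Φ) ⊆ Ω) (ρ : ContDiffBump (0 : Plane))
    (hρ : ρ.rOut ≤ δ) :
    ENNReal.ofReal (∫ x, (convolution (ρ.normed volume) (Ω.indicator u)
      (ContinuousLinearMap.lsmul ℝ ℝ) volume) x * divergence Φ x) ≤ totalVariation Ω u := by
  rcases eq_or_ne (totalVariation Ω u) ∞ with hT | hT
  · simp [hT]
  refine ENNReal.ofReal_le_of_le_toReal ?_
  set T := (totalVariation Ω u).toReal
  have hu0 : Integrable (Ω.indicator u) := hu.integrable_indicator hΩ
  obtain ⟨C, hC⟩ := exists_bound_divergence hΦ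
  have hρi : Integrable (ρ.normed volume) := ρ.integrable_normed
  have hint : Integrable (fun p : Plane × Plane =>
      (ρ.normed volume p.2 * Ω.indicator u (p.1 - p.2)) * divergence Φ p.1)
      (volume.prod volume) :=
    (hρi.convolution_integrand (ContinuousLinearMap.lsmul ℝ ℝ) hu0).mul_bdd
      ((continuous_divergence hΦ.1).comp continuous_fst).aestronglyMeasurable
      (ae_of_all _ fun p => hC p.1)
  have hswap : ∫ x, (convolution (ρ.normed volume) (Ω.indicator u)
      (ContinuousLinearMap.lsmul ℝ ℝ) volume) x * divergence Φ x
      = ∫ y, ρ.normed volume y * ∫ x, Ω.indicator u (x - y) * divergence Φ x := by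
    have : ∀ x, (convolution (ρ.normed volume) (Ω.indicator u)
        (ContinuousLinearMap.lsmul ℝ ℝ) volume) x * divergence Φ x
        = ∫ y, (ρ.normed volume y * Ω.indicator u (x - y)) * divergence Φ x := fun x => by
      rw [integral_mul_const]
      rfl
    simp_rw [this]
    rw [integral_integral_swap hint]
    simp_rw [mul_assoc, integral_const_mul]
  have hle : ∀ y, ρ.normed volume y * (∫ x, Ω.indicator u (x - y) * divergence Φ x)
      ≤ ρ.normed volume y * T := by
    intro y
    by_cases hy : y ∈ Function.support (ρ.normed volume)
    · refine mul_le_mul_of_nonneg_left ?_ (ρ.nonneg_normed y)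
      rw [ρ.support_normed_eq, mem_ball_zero_iff] at hy
      have hmem := translate_mem_testFields hΦ hδ (hy.le.trans hρ)
      have hTy := ofReal_integral_le_totalVariation u hmem
      rw [ENNReal.ofReal_le_iff_le_toReal hT] at hTy
      refine le_trans (le_of_eq ?_) hTy
      rw [← integral_indicator hΩ,
        ← integral_sub_right_eq_self (fun z => Ω.indicator _ z) y]
      refine integral_congr_ae (ae_of_all _ fun x => ?_)
      by_cases hx : x - y ∈ Ω
      · simp [hx, divergence_translate]
      · simp [hx]
    · rw [Function.notMem_support] at hy
      simp [hy]
  rw [hswap]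
  have hint' : Integrable fun y =>
      ρ.normed volume y * ∫ x, Ω.indicator u (x - y) * divergence Φ x := by
    have := hint.integral_prod_right
    simpa only [mul_assoc, integral_const_mul] using this
  calc _ ≤ ∫ y, ρ.normed volume y * T := integral_mono hint' (hρi.mul_const T) hle
    _ = T := by rw [integral_mul_const, ρ.integral_normed, one_mul]

lemma norm_convolution_normed_le {u : Plane → ℝ} {C : ℝ} (hu : ∀ᵐ x, ‖u x‖ ≤ C)
    (ρ : ContDiffBump (0 : Plane)) (x : Plane) :
    ‖(convolution (ρ.normed volume) u (ContinuousLinearMap.lsmul ℝ ℝ) volume) x‖ ≤ C := by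
  have hρi : Integrable (ρ.normed volume) := ρ.integrable_normed
  calc _ ≤ ∫ y, ρ.normed volume y * C := by
        refine norm_integral_le_of_norm_le (hρi.mul_const C) ?_
        filter_upwards [(quasiMeasurePreserving_sub_left volume x).ae hu] with y hy
        simp only [ContinuousLinearMap.lsmul_apply, norm_smul]
        rw [Real.norm_of_nonneg (ρ.nonneg_normed y)]
        exact mul_le_mul_of_nonneg_left hy (ρ.nonneg_normed y)
    _ = C := by rw [integral_mul_const, ρ.integral_normed, one_mul]

/-! ### Truncation splits the total variation -/

lemma ofReal_integral_truncation_le {Ω : Set Plane} (hΩo : IsOpen Ω) (hΩ : volume Ω < ∞)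
    {u : Plane → ℝ} (hu : u ∈ unitFunctions Ω) (t : ℝ) {φ ψ : Plane → Plane}
    (hφ : φ ∈ testFields Ω) (hψ : ψ ∈ testFields Ω) :
    ENNReal.ofReal ((∫ x in Ω, min (u x) t * divergence φ x)
      + ∫ x in Ω, (u x - min (u x) t) * divergence ψ x) ≤ totalVariation Ω u := by
  have hΩm := hΩo.measurableSet
  have hui := integrableOn_of_mem_unitFunctions hΩ hu
  have hu0 : Integrable (Ω.indicator u) := hui.integrable_indicator hΩm
  have hub : ∀ᵐ x, ‖Ω.indicator u x‖ ≤ 1 := by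
    filter_upwards [(ae_restrict_iff' hΩm).1 (norm_le_one_of_mem_unitFunctions hu)] with x hx
    by_cases hxΩ : x ∈ Ω
    · simpa [hxΩ] using hx hxΩ
    · simp [hxΩ]
  obtain ⟨δ, hδ0, hδ⟩ := (hφ.2.1.isCompact.union hψ.2.1.isCompact).exists_cthickening_subset_open
    hΩo (Set.union_subset hφ.2.2.1 hψ.2.2.1)
  let ε : ℕ → ℝ := fun n => 1 / ((n : ℝ) + 1)
  have hε0 : ∀ n, 0 < ε n := fun n => Nat.one_div_pos_of_nat
  have hε1 : ∀ n, ε n ≤ 1 := fun n => by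
    simpa [ε] using inv_le_one_of_one_le₀ (by linarith [n.cast_nonneg (α := ℝ)] : (1 : ℝ) ≤ n + 1)
  have hε : Tendsto ε atTop (𝓝 0) := tendsto_one_div_add_atTop_nhds_zero_nat
  let ρ : ℕ → ContDiffBump (0 : Plane) := fun n =>
    ⟨ε n / 2, ε n, half_pos (hε0 n), half_lt_self (hε0 n)⟩
  let v : ℕ → Plane → ℝ := fun n => convolution ((ρ n).normed volume) (Ω.indicator u)
    (ContinuousLinearMap.lsmul ℝ ℝ) volume
  have hv : ∀ n, ContDiff ℝ 1 (v n) := fun n =>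
    (ρ n).hasCompactSupport_normed.contDiff_convolution_left _ (ρ n).contDiff_normed
      hu0.locallyIntegrable
  have hvb : ∀ n x, ‖v n x‖ ≤ 1 := fun n x => norm_convolution_normed_le hub (ρ n) x
  have hvt : ∀ᵐ x ∂(volume.restrict Ω), Tendsto (fun n => v n x) atTop (𝓝 (u x)) := by
    have h : ∀ᵐ x, Tendsto (fun n => v n x) atTop (𝓝 (Ω.indicator u x)) :=
      ContDiffBump.ae_convolution_tendsto_right_of_locallyIntegrable (φ := ρ) (K := 2) hε
        (Eventually.of_forall fun n => by simp only [ρ]; linarith) hu0.locallyIntegrable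
    filter_upwards [ae_restrict_of_ae h, ae_restrict_mem hΩm] with x hx hxΩ
    simpa [hxΩ] using hx
  have hmt : ∀ᵐ x ∂(volume.restrict Ω),
      Tendsto (fun n => smoothMin t (ε n) (v n x)) atTop (𝓝 (min (u x) t)) := by
    filter_upwards [hvt] with x hx
    rw [← smoothMin_zero]
    exact ((continuous_smoothMin t).tendsto (0, u x)).comp (hε.prodMk_nhds hx)
  have hmb : ∀ n x, ‖smoothMin t (ε n) (v n x)‖ ≤ 2 + |t| := fun n x => by
    have h1 := abs_smoothMin_le t (hε0 n).le (v n x)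
    have h2 := hvb n x
    rw [Real.norm_eq_abs] at h2 ⊢
    linarith [hε1 n]
  have hmc : ∀ n, Continuous fun x => smoothMin t (ε n) (v n x) := fun n =>
    (continuous_smoothMin t).comp (continuous_const.prodMk (hv n).continuous)
  have lim1 := tendsto_integral_mul_divergence hΩ (fun n => (hmc n).aestronglyMeasurable)
    (fun n => ae_of_all _ (hmb n)) hmt hφ
  have lim2 := tendsto_integral_mul_divergence hΩ
    (u := fun n x => v n x - smoothMin t (ε n) (v n x)) (v := fun x => u x - min (u x) t)
    (C := 1 + (2 + |t|))
    (fun n => ((hv n).continuous.sub (hmc n)).aestronglyMeasurable)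
    (fun n => ae_of_all _ fun x => (norm_sub_le _ _).trans (add_le_add (hvb n x) (hmb n x)))
    (by filter_upwards [hvt, hmt] with x h1 h2 using h1.sub h2) hψ
  -- The mollified function only has to be tested near the compact supports of `φ` and `ψ`, which a
  -- small mollification radius keeps away from the boundary of `Ω`.
  refine le_of_tendsto (ENNReal.tendsto_ofReal (lim1.add lim2)) ?_
  filter_upwards [hε.eventually_le_const hδ0] with n hn
  have hΦ := weighted_mem_testFields hφ hψ
    ((contDiff_smoothMinDeriv t (hε0 n)).comp (hv n))
    (fun x => smoothMinDeriv_mem_Icc t (hε0 n) (v n x))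
  rw [setIntegral_mul_divergence_eq hφ, setIntegral_mul_divergence_eq hψ,
    integral_comp_mul_divergence_add (hv n) (hasDerivAt_smoothMin t (hε0 n))
      (contDiff_smoothMinDeriv t (hε0 n)) hφ.1 hφ.2.1 hψ.1 hψ.2.1]
  exact ofReal_integral_convolution_le hΩm hui hΦ.1
    ((Metric.cthickening_subset_of_subset δ hΦ.2).trans hδ) (ρ n) hn

/-- Truncation at a level splits the total variation. This is the hard inequality of the coarea
formula, for a single level. -/
lemma totalVariation_truncation_le {Ω : Set Plane} (hΩo : IsOpen Ω) (hΩ : volume Ω < ∞)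
    {u : Plane → ℝ} (hu : u ∈ unitFunctions Ω) (t : ℝ) :
    totalVariation Ω (fun x => min (u x) t) + totalVariation Ω (fun x => u x - min (u x) t)
      ≤ totalVariation Ω u := by
  have h0 := zero_mem_testFields Ω
  refine ENNReal.biSup_add_biSup_le ⟨0, h0⟩ ⟨0, h0⟩ fun φ hφ ψ hψ => ?_
  -- A term with a negative integral contributes nothing; its field is replaced by zero.
  rcases le_total (∫ x in Ω, min (u x) t * divergence φ x) 0 with ha | ha
  · rw [ENNReal.ofReal_of_nonpos ha, zero_add]
    simpa [divergence_zero] using ofReal_integral_truncation_le hΩo hΩ hu t h0 hψ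
  rcases le_total (∫ x in Ω, (u x - min (u x) t) * divergence ψ x) 0 with hb | hb
  · rw [ENNReal.ofReal_of_nonpos hb, add_zero]
    simpa [divergence_zero] using ofReal_integral_truncation_le hΩo hΩ hu t hφ h0
  rw [← ENNReal.ofReal_add ha hb]
  exact ofReal_integral_truncation_le hΩo hΩ hu t hφ hψ

/-! ### Existence of minimisers by the direct method -/

/-- A decreasing sequence of nonempty closed convex sets in a Hilbert space, the first of them
bounded, has a common point: by the parallelogram identity the elements of minimal norm form a
Cauchy sequence. -/
lemma nonempty_iInter_of_antitone_convex {H : Type*} [NormedAddCommGroup H]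
    [InnerProductSpace ℝ H] [CompleteSpace H] {C : ℕ → Set H} (hanti : Antitone C)
    (hne : ∀ n, (C n).Nonempty) (hcl : ∀ n, IsClosed (C n)) (hconv : ∀ n, Convex ℝ (C n))
    (hbdd : Bornology.IsBounded (C 0)) : (⋂ n, C n).Nonempty := by
  have hmin : ∀ n, ∃ x ∈ C n, ∀ y ∈ C n, ‖x‖ ≤ ‖y‖ := fun n => by
    obtain ⟨x, hx, hx'⟩ :=
      exists_norm_eq_iInf_of_complete_convex (hne n) (hcl n).isComplete (hconv n) 0
    refine ⟨x, hx, fun y hy => ?_⟩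
    simp only [zero_sub, norm_neg] at hx'
    rw [hx']
    exact ciInf_le ⟨0, by rintro _ ⟨w, rfl⟩; exact norm_nonneg _⟩ (⟨y, hy⟩ : C n)
  choose x hxC hxmin using hmin
  have hmono : Monotone fun n => ‖x n‖ ^ 2 := fun m n hmn =>
    pow_le_pow_left₀ (norm_nonneg _) (hxmin m _ (hanti hmn (hxC n))) 2
  obtain ⟨R, hR⟩ := hbdd.exists_norm_le
  have hba : BddAbove (Set.range fun n => ‖x n‖ ^ 2) := by
    refine ⟨R ^ 2, ?_⟩
    rintro _ ⟨n, rfl⟩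
    exact pow_le_pow_left₀ (norm_nonneg _) (hR _ (hanti (Nat.zero_le n) (hxC n))) 2
  have hlim := tendsto_atTop_ciSup hmono hba
  have hdist : ∀ m n, m ≤ n → ‖x n - x m‖ ^ 2 ≤ 2 * (‖x n‖ ^ 2 - ‖x m‖ ^ 2) := by
    intro m n hmn
    have hmid : (1 / 2 : ℝ) • x n + (1 / 2 : ℝ) • x m ∈ C m :=
      hconv m (hanti hmn (hxC n)) (hxC m) (by norm_num) (by norm_num) (by norm_num)
    have h1 := hxmin m _ hmid
    rw [← smul_add, norm_smul] at h1
    have h2 := parallelogram_law_with_norm ℝ (x n) (x m)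
    norm_num at h1
    nlinarith [norm_nonneg (x m), norm_nonneg (x n + x m)]
  have hcauchy : CauchySeq x := by
    rw [Metric.cauchySeq_iff']
    intro ε hε
    obtain ⟨N, hN⟩ := (hlim.eventually (lt_mem_nhds
      (sub_lt_self (⨆ n, ‖x n‖ ^ 2) (by positivity : 0 < ε ^ 2 / 2)))).exists
    refine ⟨N, fun n hn => ?_⟩
    have h1 := hdist N n hn
    have h2 := le_ciSup hba n
    rw [dist_eq_norm]
    refine lt_of_pow_lt_pow_left₀ 2 hε.le ?_
    linarith
  obtain ⟨y, hy⟩ := cauchySeq_tendsto_of_complete hcauchy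
  refine ⟨y, Set.mem_iInter.2 fun n => (hcl n).mem_of_tendsto hy ?_⟩
  filter_upwards [eventually_ge_atTop n] with k hk using hanti hk (hxC k)

lemma zero_mem_unitFunctions (Ω : Set Plane) : (0 : Plane → ℝ) ∈ unitFunctions Ω :=
  ⟨aestronglyMeasurable_const, by simp⟩

lemma unitFunctions_congr {Ω : Set Plane} {u v : Plane → ℝ} (h : u =ᵐ[volume.restrict Ω] v)
    (hu : u ∈ unitFunctions Ω) : v ∈ unitFunctions Ω := by
  refine ⟨hu.1.congr h, ?_⟩
  filter_upwards [h, hu.2] with x hx hux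
  rwa [← hx]

/-- The sublevel sets of the energy, intersected with `unitFunctions Ω`, as subsets of
`L²(Ω)`. -/
def sublevelL2 (Ω : Set Plane) (lam : ℝ) (p q : Plane → ℝ) (c : ℝ≥0∞) :
    Set (Lp ℝ 2 (volume.restrict Ω)) :=
  {g | (g : Plane → ℝ) ∈ unitFunctions Ω ∧ tvEnergy Ω lam p q g ≤ c}

section

variable {Ω : Set Plane} (hΩ : volume Ω < ∞) {lam : ℝ} {p q : Plane → ℝ}
    (hp : AEMeasurable p (volume.restrict Ω)) (hq : AEMeasurable q (volume.restrict Ω))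

include hΩ hp hq

lemma isClosed_sublevelL2 (c : ℝ≥0∞) : IsClosed (sublevelL2 Ω lam p q c) := by
  refine IsSeqClosed.isClosed fun g f hg hgf => ?_
  obtain ⟨k, -, hk⟩ := (tendstoInMeasure_of_tendsto_Lp hgf).exists_seq_tendsto_ae
  exact ⟨mem_unitFunctions_of_tendsto (fun n => (hg (k n)).1) hk,
    tvEnergy_le_of_tendsto hΩ hp hq (fun n => (hg (k n)).1) hk fun n => (hg (k n)).2⟩

lemma convex_sublevelL2 (hp0 : ∀ x, 0 ≤ p x) (hq0 : ∀ x, 0 ≤ q x) (c : ℝ≥0∞) :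
    Convex ℝ (sublevelL2 Ω lam p q c) := by
  intro f hf g hg a b ha hb hab
  have hae : (fun x => a * f x + b * g x)
      =ᵐ[volume.restrict Ω] (a • f + b • g : Lp ℝ 2 (volume.restrict Ω)) := by
    filter_upwards [Lp.coeFn_add (a • f) (b • g), Lp.coeFn_smul a f, Lp.coeFn_smul b g]
      with x h1 h2 h3
    rw [h1, Pi.add_apply, h2, h3]
    rfl
  refine ⟨unitFunctions_congr hae (convexCombination_mem_unitFunctions ha hb hab hf.1 hg.1), ?_⟩
  rw [← tvEnergy_congr hae]
  calc _ ≤ ENNReal.ofReal a * tvEnergy Ω lam p q f + ENNReal.ofReal b * tvEnergy Ω lam p q g :=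
        tvEnergy_convexCombination_le hΩ hp hq hp0 hq0 ha hb hab hf.1 hg.1
    _ ≤ ENNReal.ofReal a * c + ENNReal.ofReal b * c :=
        add_le_add (mul_le_mul_right hf.2 _) (mul_le_mul_right hg.2 _)
    _ = c := by rw [← add_mul, ← ENNReal.ofReal_add ha hb, hab, ENNReal.ofReal_one, one_mul]

lemma exists_isMinOn_tvEnergy (hp0 : ∀ x, 0 ≤ p x) (hq0 : ∀ x, 0 ≤ q x) :
    ∃ u ∈ unitFunctions Ω, IsMinOn (tvEnergy Ω lam p q) (unitFunctions Ω) u := by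
  have : IsFiniteMeasure (volume.restrict Ω) := ⟨by simpa using hΩ⟩
  set m := ⨅ v ∈ unitFunctions Ω, tvEnergy Ω lam p q v with hm
  have hmle : ∀ v ∈ unitFunctions Ω, m ≤ tvEnergy Ω lam p q v := fun v hv => iInf₂_le v hv
  suffices h : ∃ u ∈ unitFunctions Ω, tvEnergy Ω lam p q u ≤ m by
    obtain ⟨u, hu, hum⟩ := h
    exact ⟨u, hu, fun v hv => hum.trans (hmle v hv)⟩
  rcases eq_or_ne m ∞ with hmtop | hmtop
  · exact ⟨0, zero_mem_unitFunctions Ω, by simp [hmtop]⟩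
  let c : ℕ → ℝ≥0∞ := fun n => m + (n : ℝ≥0∞)⁻¹
  have hanti : Antitone fun n => sublevelL2 Ω lam p q (c n) := fun k n hkn g hg =>
    ⟨hg.1, hg.2.trans (add_le_add_right (ENNReal.inv_le_inv.2 (by exact_mod_cast hkn)) _)⟩
  have hne : ∀ n, (sublevelL2 Ω lam p q (c n)).Nonempty := fun n => by
    have hlt : m < c n :=
      ENNReal.lt_add_right hmtop (ENNReal.inv_ne_zero.2 (ENNReal.natCast_ne_top n))
    rw [hm] at hlt
    simp only [iInf_lt_iff] at hlt
    obtain ⟨v, hv, hvc⟩ := hlt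
    have hmem : MemLp v 2 (volume.restrict Ω) :=
      MemLp.of_bound hv.1 1 (norm_le_one_of_mem_unitFunctions hv)
    refine ⟨hmem.toLp v, unitFunctions_congr hmem.coeFn_toLp.symm hv, ?_⟩
    rw [tvEnergy_congr hmem.coeFn_toLp]
    exact hvc.le
  have hbdd : Bornology.IsBounded (sublevelL2 Ω lam p q (c 0)) :=
    isBounded_iff_forall_norm_le.2 ⟨_, fun g hg =>
      Lp.norm_le_of_ae_bound zero_le_one (norm_le_one_of_mem_unitFunctions hg.1)⟩
  obtain ⟨g, hg⟩ := nonempty_iInter_of_antitone_convex hanti hne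
    (fun n => isClosed_sublevelL2 hΩ hp hq (c n))
    (fun n => convex_sublevelL2 hΩ hp hq hp0 hq0 (c n)) hbdd
  rw [Set.mem_iInter] at hg
  have hc : Tendsto c atTop (𝓝 (m + 0)) :=
    tendsto_const_nhds.add ENNReal.tendsto_inv_nat_nhds_zero
  rw [add_zero] at hc
  exact ⟨g, (hg 0).1, ge_of_tendsto' hc fun n => (hg n).2⟩

end

/-! ### Truncations and superlevel sets of minimisers -/

lemma truncation_mem_unitFunctions {Ω : Set Plane} {u : Plane → ℝ} (hu : u ∈ unitFunctions Ω)
    {t : ℝ} (ht0 : 0 < t) (ht1 : t < 1) :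
    (fun x => min (u x) t / t) ∈ unitFunctions Ω ∧
      (fun x => (u x - min (u x) t) / (1 - t)) ∈ unitFunctions Ω := by
  have hm : AEStronglyMeasurable (fun x => min (u x) t) (volume.restrict Ω) :=
    hu.1.inf aestronglyMeasurable_const
  have ht1' : 0 < 1 - t := by linarith
  refine ⟨⟨by simpa only [div_eq_mul_inv] using hm.mul_const t⁻¹, ?_⟩,
    ⟨by simpa only [div_eq_mul_inv, Pi.sub_apply] using (hu.1.sub hm).mul_const (1 - t)⁻¹, ?_⟩⟩
  · filter_upwards [hu.2] with x hx
    exact ⟨div_nonneg (le_min hx.1 ht0.le) ht0.le, (div_le_one ht0).2 (min_le_right _ _)⟩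
  · filter_upwards [hu.2] with x hx
    refine ⟨div_nonneg (sub_nonneg.2 (min_le_left _ _)) ht1'.le, (div_le_one ht1').2 ?_⟩
    rcases le_total (u x) t with h | h
    · rw [min_eq_left h]; linarith
    · rw [min_eq_right h]; linarith [hx.2]

section

variable {Ω : Set Plane} (hΩo : IsOpen Ω) (hΩ : volume Ω < ∞) {lam : ℝ} {p q : Plane → ℝ}
    (hp : AEMeasurable p (volume.restrict Ω)) (hq : AEMeasurable q (volume.restrict Ω))
    (hp0 : ∀ x, 0 ≤ p x) (hq0 : ∀ x, 0 ≤ q x)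

include hΩo hΩ hp hq hp0 hq0

/-- The energy is affine along the decomposition of `u` into its two normalised truncations at the
level `t` (one of the two inequalities; the other is convexity). -/
lemma tvEnergy_truncation_le {u : Plane → ℝ} (hu : u ∈ unitFunctions Ω) {t : ℝ} (ht0 : 0 < t)
    (ht1 : t < 1) :
    ENNReal.ofReal t * tvEnergy Ω lam p q (fun x => min (u x) t / t)
      + ENNReal.ofReal (1 - t) * tvEnergy Ω lam p q (fun x => (u x - min (u x) t) / (1 - t))
      ≤ tvEnergy Ω lam p q u := by
  obtain ⟨hv, hw⟩ := truncation_mem_unitFunctions hu ht0 ht1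
  have ht1' : 0 < 1 - t := by linarith
  have htv := totalVariation_truncation_le hΩo hΩ hu t
  have e1 : (fun x => min (u x) t) = fun x => t * (min (u x) t / t) := by
    ext x
    field_simp
  have e2 : (fun x => u x - min (u x) t) = fun x => (1 - t) * ((u x - min (u x) t) / (1 - t)) := by
    ext x
    field_simp
  have e3 : u = fun x => t * (min (u x) t / t) + (1 - t) * ((u x - min (u x) t) / (1 - t)) := by
    ext x
    field_simp
    ring
  rw [e1, e2, totalVariation_const_mul Ω ht0.le, totalVariation_const_mul Ω ht1'.le] at htv
  have hdata := lintegral_data_convexCombination hp hq hp0 hq0 ht0.le ht1'.le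
    (by ring) hv hw
  have hsplit : tvEnergy Ω lam p q u = ENNReal.ofReal lam * totalVariation Ω u
      + ∫⁻ x in Ω, (ENNReal.ofReal (p x
          * (t * (min (u x) t / t) + (1 - t) * ((u x - min (u x) t) / (1 - t))))
        + ENNReal.ofReal (q x
          * (1 - (t * (min (u x) t / t) + (1 - t) * ((u x - min (u x) t) / (1 - t)))))) := by
    unfold tvEnergy
    congr 1
    refine lintegral_congr fun x => ?_
    rw [← congrFun e3 x]
  rw [hsplit, hdata]
  refine le_trans (le_of_eq ?_) (add_le_add_left (mul_le_mul_right htv _) _)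
  unfold tvEnergy
  ring

/-- Both normalised truncations of a minimiser are minimisers, since the energy of the minimiser is
a weighted mean of theirs. -/
lemma isMinOn_truncation {u : Plane → ℝ} (hu : u ∈ unitFunctions Ω)
    (hmin : IsMinOn (tvEnergy Ω lam p q) (unitFunctions Ω) u) {t : ℝ} (ht0 : 0 < t)
    (ht1 : t < 1) :
    IsMinOn (tvEnergy Ω lam p q) (unitFunctions Ω) (fun x => min (u x) t / t) ∧
      IsMinOn (tvEnergy Ω lam p q) (unitFunctions Ω)
        (fun x => (u x - min (u x) t) / (1 - t)) := by
  obtain ⟨hv, hw⟩ := truncation_mem_unitFunctions hu ht0 ht1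
  have ht1' : 0 < 1 - t := by linarith
  set v := fun x => min (u x) t / t
  set w := fun x => (u x - min (u x) t) / (1 - t)
  set m := tvEnergy Ω lam p q u with hm
  suffices h : tvEnergy Ω lam p q v ≤ m ∧ tvEnergy Ω lam p q w ≤ m from
    ⟨fun z hz => h.1.trans (hmin hz), fun z hz => h.2.trans (hmin hz)⟩
  rcases eq_or_ne m ∞ with hmtop | hmtop
  · simp [hmtop]
  have key : ENNReal.ofReal t * tvEnergy Ω lam p q v
      + ENNReal.ofReal (1 - t) * tvEnergy Ω lam p q w
      ≤ ENNReal.ofReal t * m + ENNReal.ofReal (1 - t) * m := by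
    rw [← add_mul, ← ENNReal.ofReal_add ht0.le ht1'.le, add_sub_cancel, ENNReal.ofReal_one,
      one_mul]
    exact tvEnergy_truncation_le hΩo hΩ hp hq hp0 hq0 hu ht0 ht1
  have hvm : m ≤ tvEnergy Ω lam p q v := hmin hv
  have hwm : m ≤ tvEnergy Ω lam p q w := hmin hw
  constructor
  · have h := (add_le_add_right (mul_le_mul_right hwm (ENNReal.ofReal (1 - t))) _).trans key
    rw [ENNReal.add_le_add_iff_right (ENNReal.mul_ne_top ENNReal.ofReal_ne_top hmtop)] at h
    exact (ENNReal.mul_le_mul_iff_right (by simpa using ht0) ENNReal.ofReal_ne_top).1 h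
  · have h := (add_le_add_left (mul_le_mul_right hvm (ENNReal.ofReal t)) _).trans key
    rw [ENNReal.add_le_add_iff_left (ENNReal.mul_ne_top ENNReal.ofReal_ne_top hmtop)] at h
    exact (ENNReal.mul_le_mul_iff_right (by simpa using ht1') ENNReal.ofReal_ne_top).1 h

/-- The characteristic function of a superlevel set of a minimiser is a limit of iterated
truncations, hence a minimiser. -/
lemma isMinOn_indicator_superlevelSet {u : Plane → ℝ} (hu : u ∈ unitFunctions Ω)
    (hmin : IsMinOn (tvEnergy Ω lam p q) (unitFunctions Ω) u) {τ : ℝ} (hτ0 : 0 < τ)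
    (hτ1 : τ < 1) :
    IsMinOn (tvEnergy Ω lam p q) (unitFunctions Ω)
      ((superlevelSet Ω u τ).indicator fun _ => (1 : ℝ)) := by
  have hv := (truncation_mem_unitFunctions hu hτ0 hτ1).1
  have hvmin := (isMinOn_truncation hΩo hΩ hp hq hp0 hq0 hu hmin hτ0 hτ1).1
  set v := fun x => min (u x) τ / τ with hvdef
  let s : ℕ → ℝ := fun n => 1 - 1 / ((n : ℝ) + 2)
  have hs0 : ∀ n, 0 < s n := fun n => by
    have : 1 / ((n : ℝ) + 2) < 1 := by
      rw [div_lt_one (by positivity)]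
      linarith [n.cast_nonneg (α := ℝ)]
    simp only [s]
    linarith
  have hs1 : ∀ n, s n < 1 := fun n => by
    have : 0 < 1 / ((n : ℝ) + 2) := by positivity
    simp only [s]
    linarith
  have hst : Tendsto s atTop (𝓝 1) := by
    have h := (tendsto_one_div_add_atTop_nhds_zero_nat (𝕜 := ℝ)).comp (tendsto_add_atTop_nat 1)
    have h' : Tendsto (fun n : ℕ => 1 / ((n : ℝ) + 2)) atTop (𝓝 0) := by
      refine h.congr fun n => ?_
      simp only [Function.comp_apply]
      push_cast
      ring_nf
    simpa [s] using h'.const_sub 1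
  have hlim : ∀ᵐ x ∂(volume.restrict Ω),
      Tendsto (fun n => (v x - min (v x) (s n)) / (1 - s n)) atTop
        (𝓝 ((superlevelSet Ω u τ).indicator (fun _ => (1 : ℝ)) x)) := by
    filter_upwards [ae_restrict_mem hΩo.measurableSet] with x hxΩ
    by_cases hx : τ ≤ u x
    · have hv1 : v x = 1 := by simp [hvdef, hx, hτ0.ne']
      rw [Set.indicator_of_mem (show x ∈ superlevelSet Ω u τ from ⟨hxΩ, hx⟩)]
      refine tendsto_const_nhds.congr fun n => ?_
      rw [hv1, min_eq_right (hs1 n).le, div_self (by linarith [hs1 n])]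
    · have hv1 : v x < 1 := by
        rw [hvdef]
        simp only
        rw [min_eq_left (not_le.1 hx).le, div_lt_one hτ0]
        exact not_le.1 hx
      rw [Set.indicator_of_notMem (show x ∉ superlevelSet Ω u τ from fun h => hx h.2)]
      refine tendsto_const_nhds.congr' ?_
      filter_upwards [hst.eventually (lt_mem_nhds hv1)] with n hn
      rw [min_eq_left hn.le, sub_self, zero_div]
  refine fun z hz => (tvEnergy_le_of_tendsto hΩ hp hq
    (fun n => (truncation_mem_unitFunctions hv (hs0 n) (hs1 n)).2) hlim
    fun n => ?_)
  exact (isMinOn_truncation hΩo hΩ hp hq hp0 hq0 hv hvmin (hs0 n) (hs1 n)).2 hz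

end

/-! ### Comparison with the relaxed energy and the region energy -/

lemma mem_unitFunctions_of_mem_admissibleSet {Ω : Set Plane} {u : Plane → ℝ}
    (hu : u ∈ admissibleSet Ω) : u ∈ unitFunctions Ω :=
  ⟨hu.1.1.aestronglyMeasurable, hu.2⟩

lemma tvEnergy_eq_top_of_notMem_BV {Ω : Set Plane} (hΩ : volume Ω < ∞) {lam : ℝ} (hlam : 0 < lam)
    (p q : Plane → ℝ) {u : Plane → ℝ} (hu : u ∈ unitFunctions Ω) (h : u ∉ BV Ω) :
    tvEnergy Ω lam p q u = ∞ := by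
  have hT : totalVariation Ω u = ∞ := by
    by_contra hT
    exact h ⟨integrableOn_of_mem_unitFunctions hΩ hu, lt_top_iff_ne_top.2 hT⟩
  rw [tvEnergy, hT, ENNReal.mul_top (by simpa using hlam), top_add]

lemma indicator_mem_unitFunctions {Ω S : Set Plane} (hS : S ∈ regions Ω) :
    S.indicator (fun _ => (1 : ℝ)) ∈ unitFunctions Ω := by
  refine ⟨(aestronglyMeasurable_const.indicator₀ hS.2).restrict, ae_of_all _ fun x => ?_⟩
  by_cases hx : x ∈ S <;> simp [hx]

lemma superlevelSet_mem_regions {Ω : Set Plane} (hΩ : MeasurableSet Ω) {u : Plane → ℝ}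
    (hu : AEStronglyMeasurable u (volume.restrict Ω)) (τ : ℝ) :
    superlevelSet Ω u τ ∈ regions Ω := by
  refine ⟨fun x hx => hx.1, ?_⟩
  have h0 : AEMeasurable (Ω.indicator u) volume :=
    (aemeasurable_indicator_iff hΩ).2 hu.aemeasurable
  have h1 : NullMeasurableSet (Ω ∩ Ω.indicator u ⁻¹' Set.Ici τ) volume :=
    hΩ.nullMeasurableSet.inter (h0.nullMeasurable measurableSet_Ici)
  convert! h1 using 1
  ext x
  simp only [superlevelSet, Set.mem_ofPred_eq, Set.mem_inter_iff, Set.mem_preimage, Set.mem_Ici]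
  exact and_congr_right fun hx => by rw [Set.indicator_of_mem hx]

section

variable {d L₁ L₂ : ℕ} {Ω : Set Plane} {lam : ℝ}
  (DF : (Fin L₁ → ℝ) → Image d → Image d) (DB : (Fin L₂ → ℝ) → Image d → Image d)
  (f : Image d) (W : (Fin L₁ → ℝ) × (Fin L₂ → ℝ))

lemma relaxedEnergy_eq_top {u : Plane → ℝ} (hu : u ∉ admissibleSet Ω) :
    relaxedEnergy Ω lam DF DB f W u = ∞ := by
  simp [relaxedEnergy, boxIndicator, hu]

lemma relaxedEnergy_eq_tvEnergy (hΩ : volume Ω < ∞) (hlam : 0 < lam)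
    (hp : AEMeasurable (fun x => ‖f x - DF W.1 f x‖ ^ 2) (volume.restrict Ω))
    {u : Plane → ℝ} (hu : u ∈ unitFunctions Ω) :
    relaxedEnergy Ω lam DF DB f W u = tvEnergy Ω lam (fun x => ‖f x - DF W.1 f x‖ ^ 2)
      (fun x => ‖f x - DB W.2 f x‖ ^ 2) u := by
  by_cases hBV : u ∈ BV Ω
  · have hpu : AEMeasurable (fun x => ‖f x - DF W.1 f x‖ ^ 2 * u x) (volume.restrict Ω) :=
      hp.mul hu.1.aemeasurable
    have hadm : u ∉ (admissibleSet Ω)ᶜ := fun h => h ⟨hBV, hu.2⟩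
    rw [relaxedEnergy, tvEnergy, boxIndicator, Set.indicator_of_notMem hadm, zero_add, add_assoc,
      lintegral_add_left' hpu.ennreal_ofReal]
  · rw [relaxedEnergy_eq_top DF DB f W fun h => hBV h.1,
      tvEnergy_eq_top_of_notMem_BV hΩ hlam _ _ hu hBV]

lemma regionEnergy_eq_tvEnergy
    (hp : AEMeasurable (fun x => ‖f x - DF W.1 f x‖ ^ 2) (volume.restrict Ω))
    {S : Set Plane} (hS : S ∈ regions Ω) :
    regionEnergy Ω lam DF DB f W S = tvEnergy Ω lam (fun x => ‖f x - DF W.1 f x‖ ^ 2)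
      (fun x => ‖f x - DB W.2 f x‖ ^ 2) (S.indicator fun _ => 1) := by
  have hSm : NullMeasurableSet S (volume.restrict Ω) :=
    hS.2.mono_ac Measure.absolutelyContinuous_restrict
  have hsum : ∀ x, ENNReal.ofReal (‖f x - DF W.1 f x‖ ^ 2 * S.indicator (fun _ => (1 : ℝ)) x)
      + ENNReal.ofReal (‖f x - DB W.2 f x‖ ^ 2 * (1 - S.indicator (fun _ => (1 : ℝ)) x))
      = S.indicator (fun x => ENNReal.ofReal (‖f x - DF W.1 f x‖ ^ 2)) x
        + Sᶜ.indicator (fun x => ENNReal.ofReal (‖f x - DB W.2 f x‖ ^ 2)) x := fun x => by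
    by_cases hx : x ∈ S <;> simp [hx]
  rw [regionEnergy, tvEnergy, perimeter, lintegral_congr hsum,
    lintegral_add_left' (hp.ennreal_ofReal.indicator₀ hSm), lintegral_indicator₀ hSm,
    lintegral_indicator₀ hSm.compl, Measure.restrict_restrict₀ hSm,
    Measure.restrict_restrict₀ hSm.compl, Set.inter_eq_left.2 hS.1, Set.inter_comm,
    ← Set.sdiff_eq, add_assoc]

end

/-! ### Minimisers of the relaxed energy and their superlevel sets -/

theorem theorem2 {d L₁ L₂ : ℕ} (Ω : Set Plane) (hΩo : IsOpen Ω) (hΩb : Bornology.IsBounded Ω)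
    (lam : ℝ) (hlam : 0 < lam)
    (DF : (Fin L₁ → ℝ) → Image d → Image d) (DB : (Fin L₂ → ℝ) → Image d → Image d)
    (f : Image d) (W : (Fin L₁ → ℝ) × (Fin L₂ → ℝ))
    (hf : AEStronglyMeasurable f (volume.restrict Ω))
    (hF : AEStronglyMeasurable (DF W.1 f) (volume.restrict Ω))
    (hB : AEStronglyMeasurable (DB W.2 f) (volume.restrict Ω)) :
    (∃ u ∈ BV Ω, IsMinOn (relaxedEnergy Ω lam DF DB f W) (BV Ω) u) ∧
    ∀ u ∈ BV Ω, IsMinOn (relaxedEnergy Ω lam DF DB f W) (BV Ω) u →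
      ∀ᵐ τ ∂(volume.restrict (Set.Icc (0 : ℝ) 1)),
        superlevelSet Ω u τ ∈ regions Ω ∧
        IsMinOn (regionEnergy Ω lam DF DB f W) (regions Ω) (superlevelSet Ω u τ) := by
  set p : Plane → ℝ := fun x => ‖f x - DF W.1 f x‖ ^ 2
  set q : Plane → ℝ := fun x => ‖f x - DB W.2 f x‖ ^ 2
  have hp : AEMeasurable p (volume.restrict Ω) := ((hf.sub hF).norm.pow 2).aemeasurable
  have hq : AEMeasurable q (volume.restrict Ω) := ((hf.sub hB).norm.pow 2).aemeasurable
  have hp0 : ∀ x, 0 ≤ p x := fun x => sq_nonneg _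
  have hq0 : ∀ x, 0 ≤ q x := fun x => sq_nonneg _
  have hΩ : volume Ω < ∞ := hΩb.measure_lt_top
  have hrel : ∀ v ∈ unitFunctions Ω, relaxedEnergy Ω lam DF DB f W v = tvEnergy Ω lam p q v :=
    fun v hv => relaxedEnergy_eq_tvEnergy DF DB f W hΩ hlam hp hv
  have hreg : ∀ S ∈ regions Ω, regionEnergy Ω lam DF DB f W S
      = tvEnergy Ω lam p q (S.indicator fun _ => 1) :=
    fun S hS => regionEnergy_eq_tvEnergy DF DB f W hp hS
  constructor
  · obtain ⟨u, hu, hmin⟩ := exists_isMinOn_tvEnergy (lam := lam) hΩ hp hq hp0 hq0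
    have hle : ∀ v, tvEnergy Ω lam p q u ≤ relaxedEnergy Ω lam DF DB f W v := fun v => by
      by_cases hv : v ∈ admissibleSet Ω
      · have hv' := mem_unitFunctions_of_mem_admissibleSet hv
        rw [hrel v hv']
        exact hmin hv'
      · simp [relaxedEnergy_eq_top DF DB f W hv]
    by_cases hBV : u ∈ BV Ω
    · refine ⟨u, hBV, fun v _ => ?_⟩
      rw [Set.mem_ofPred_eq, hrel u hu]
      exact hle v
    -- The energy of a minimiser outside `BV Ω` is infinite, and then so is every energy.
    · refine ⟨0, ⟨integrableOn_zero, by simp [totalVariation_zero]⟩, fun v _ => ?_⟩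
      have hv := hle v
      rw [tvEnergy_eq_top_of_notMem_BV hΩ hlam p q hu hBV, top_le_iff] at hv
      simp [hv]
  · intro u hu hmin
    rw [← Measure.restrict_congr_set Ioo_ae_eq_Icc]
    refine ae_restrict_of_forall_mem measurableSet_Ioo fun τ hτ => ?_
    have hS := superlevelSet_mem_regions hΩo.measurableSet hu.1.aestronglyMeasurable τ
    have hle : ∀ v ∈ unitFunctions Ω,
        relaxedEnergy Ω lam DF DB f W u ≤ tvEnergy Ω lam p q v := fun v hv => by
      by_cases hBV : v ∈ BV Ω
      · rw [← hrel v hv]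
        exact hmin hBV
      · simp [tvEnergy_eq_top_of_notMem_BV hΩ hlam p q hv hBV]
    refine ⟨hS, fun T hT => ?_⟩
    have hTu := indicator_mem_unitFunctions hT
    rw [Set.mem_ofPred_eq, hreg _ hS, hreg T hT]
    by_cases hadm : u ∈ admissibleSet Ω
    · have hu' := mem_unitFunctions_of_mem_admissibleSet hadm
      rw [hrel u hu'] at hle
      exact isMinOn_indicator_superlevelSet hΩo hΩ hp hq hp0 hq0 hu' hle hτ.1 hτ.2 hTu
    -- A minimiser that is not admissible has infinite energy, and then so has every region.
    · have h := hle _ hTu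
      rw [relaxedEnergy_eq_top DF DB f W hadm, top_le_iff] at h
      simp [h]
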